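/- Work on a real RAM (unit-cost exact real arithmetic and comparisons, and unit-cost integer addition, subtraction and comparison, with indirectly addressed memory; programs contain only integer constants). There exist a single deterministic program $A$ and an absolute constant $C>0$ with the following properties. The input of $A$ consists of integers $n\ge 1$ and $q\ge 0$, a real $\varepsilon\in(0,1]$, and $q$ points of $\mathbb{R}^n$, and on every input $A$ halts and outputs accept or reject within $\mathrm{poly}(q,n^{\log n})$ steps, i.e. within $K\,(q+n^{\log n})^{K}$ steps for an absolute constant $K$. Moreover, for all $n\ge1$, $\varepsilon\in(0,1]$ and $$q\;\ge\; C\cdot\frac{\sqrt n}{\varepsilon^2},$$ when the $q$ points are i.i.d. samples from a Gaussian distribution $p$ on $\mathbb{R}^n$: * if $p=\mathcal N(0_n,I_n)$, then $A$ outputs accept with probability at least $2/3$; * if $p=\mathcal N(\mu,\Sigma)$ with $\|\mu\|_2>\varepsilon$ and $\Sigma$ any positive semidefinite matrix, then $A$ outputs reject with probability at least $2/3$. Conversely, this sample complexity is optimal: there is an absolute constant $c>0$ such that for all $n\ge 1$ and $\varepsilon\in(0,1]$, every (possibly randomized) procedure which, from $q$ i.i.d. samples of $p$, has the two properties above for this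 $n$ and $\varepsilon$ must use $q\ge c\,\sqrt n/\varepsilon^2$ samples. -/

import Mathlib

open MeasureTheory ProbabilityTheory
open scoped ENNReal

noncomputable section

/-! ### A real RAM with a step count

A machine works on finitely many (per program) integer registers and real registers, and on an
unbounded integer memory and an unbounded real memory which are addressed indirectly, through
integer registers.  A program is one fixed finite object, with integer constants only, which serves
inputs of all sizes.  Integers can only be added and subtracted at unit cost (so that their bit
length grows at most linearly with time); reals admit exact unit-cost arithmetic and comparisons,
and there is no rounding of reals to integers. -/

namespace RealRAM

/-- The contents of the registers and of the memory. -/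
structure State where
  natReg : ℕ → ℕ
  natMem : ℕ → ℕ
  realReg : ℕ → ℝ
  realMem : ℕ → ℝ

/-- Elementary instructions; `d` is always the index of the destination register. -/
inductive Instr where
  | natConst (d c : ℕ)
  | natAdd (d a b : ℕ)
  | natSub (d a b : ℕ)
  | natLoad (d a : ℕ)
  | natStore (a b : ℕ)
  | realConst (d : ℕ) (c : ℤ)
  | realOfNat (d a : ℕ)
  | realAdd (d a b : ℕ)
  | realSub (d a b : ℕ)
  | realMul (d a b : ℕ)
  | realDiv (d a b : ℕ)
  | realLoad (d a : ℕ)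
  | realStore (a b : ℕ)

/-- The effect of an instruction. `natSub` is truncated subtraction, and `realDiv` by zero
yields zero. -/
def Instr.run : Instr → State → State
  | .natConst d c, s => { s with natReg := Function.update s.natReg d c }
  | .natAdd d a b, s =>
      { s with natReg := Function.update s.natReg d (s.natReg a + s.natReg b) }
  | .natSub d a b, s =>
      { s with natReg := Function.update s.natReg d (s.natReg a - s.natReg b) }
  | .natLoad d a, s => { s with natReg := Function.update s.natReg d (s.natMem (s.natReg a)) }
  | .natStore a b, s => { s with natMem := Function.update s.natMem (s.natReg a) (s.natReg b) }
  | .realConst d c, s => { s with realReg := Function.update s.realReg d (c : ℝ) }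
  | .realOfNat d a, s => { s with realReg := Function.update s.realReg d (s.natReg a : ℝ) }
  | .realAdd d a b, s =>
      { s with realReg := Function.update s.realReg d (s.realReg a + s.realReg b) }
  | .realSub d a b, s =>
      { s with realReg := Function.update s.realReg d (s.realReg a - s.realReg b) }
  | .realMul d a b, s =>
      { s with realReg := Function.update s.realReg d (s.realReg a * s.realReg b) }
  | .realDiv d a b, s =>
      { s with realReg := Function.update s.realReg d (s.realReg a / s.realReg b) }
  | .realLoad d a, s => { s with realReg := Function.update s.realReg d (s.realMem (s.natReg a)) }
  | .realStore a b, s => { s with realMem := Function.update s.realMem (s.natReg a) (s.realReg b) }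

/-- Tests: comparison of two integer registers or of two real registers. -/
inductive Test where
  | natLt (a b : ℕ)
  | realLt (a b : ℕ)

/-- The test succeeds in the given state. -/
def Test.Holds : Test → State → Prop
  | .natLt a b, s => s.natReg a < s.natReg b
  | .realLt a b, s => s.realReg a < s.realReg b

/-- Programs: elementary instructions, composed by sequencing, branching and loops. -/
inductive Prog where
  | skip
  | instr (i : Instr)
  | seq (P Q : Prog)
  | ite (c : Test) (P Q : Prog)
  | loop (c : Test) (P : Prog)

/-- `Exec P s t s'`: started in state `s`, the program `P` halts in state `s'` after exactly `t`
steps. Each elementary instruction and each evaluation of a test is one step. -/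
inductive Exec : Prog → State → ℕ → State → Prop where
  | skip (s : State) : Exec .skip s 1 s
  | instr (i : Instr) (s : State) : Exec (.instr i) s 1 (i.run s)
  | seq {P Q : Prog} {s s' s'' : State} {t t' : ℕ} :
      Exec P s t s' → Exec Q s' t' s'' → Exec (.seq P Q) s (t + t') s''
  | iteTrue {c : Test} {P Q : Prog} {s s' : State} {t : ℕ} :
      c.Holds s → Exec P s t s' → Exec (.ite c P Q) s (t + 1) s'
  | iteFalse {c : Test} {P Q : Prog} {s s' : State} {t : ℕ} :
      ¬ c.Holds s → Exec Q s t s' → Exec (.ite c P Q) s (t + 1) s'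
  | loopFalse {c : Test} {P : Prog} {s : State} :
      ¬ c.Holds s → Exec (.loop c P) s 1 s
  | loopTrue {c : Test} {P : Prog} {s s' s'' : State} {t t' : ℕ} :
      c.Holds s → Exec P s t s' → Exec (.loop c P) s' t' s'' →
      Exec (.loop c P) s (t + t' + 1) s''

/-- The machine is deterministic: final state and number of steps are determined. -/
theorem Exec.unique {P : Prog} {s s₁ s₂ : State} {t₁ t₂ : ℕ}
    (h₁ : Exec P s t₁ s₁) (h₂ : Exec P s t₂ s₂) : t₁ = t₂ ∧ s₁ = s₂ := by
  induction h₁ generalizing t₂ s₂ with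
  | skip => cases h₂; exact ⟨rfl, rfl⟩
  | instr => cases h₂; exact ⟨rfl, rfl⟩
  | seq _ _ ih ih' =>
    cases h₂ with
    | seq k k' =>
      obtain ⟨rfl, rfl⟩ := ih k
      obtain ⟨rfl, rfl⟩ := ih' k'
      exact ⟨rfl, rfl⟩
  | iteTrue hc _ ih =>
    cases h₂ with
    | iteTrue _ k => obtain ⟨rfl, rfl⟩ := ih k; exact ⟨rfl, rfl⟩
    | iteFalse hc' _ => exact absurd hc hc'
  | iteFalse hc _ ih =>
    cases h₂ with
    | iteTrue hc' _ => exact absurd hc' hc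
    | iteFalse _ k => obtain ⟨rfl, rfl⟩ := ih k; exact ⟨rfl, rfl⟩
  | loopFalse hc =>
    cases h₂ with
    | loopFalse => exact ⟨rfl, rfl⟩
    | loopTrue hc' _ _ => exact absurd hc' hc
  | loopTrue hc _ _ ih ih' =>
    cases h₂ with
    | loopFalse hc' => exact absurd hc hc'
    | loopTrue _ k k' =>
      obtain ⟨rfl, rfl⟩ := ih k
      obtain ⟨rfl, rfl⟩ := ih' k'
      exact ⟨rfl, rfl⟩

/-- The initial state on input `(n, q, ε, x)`: the dimension `n` and the number `q` of samples in
the integer registers `0` and `1`, the parameter `ε` in the real register `0`, coordinate `j` of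
sample `i` in the cell `j + n * i` of the real memory, and zero everywhere else. -/
def input (n q : ℕ) (ε : ℝ) (x : Fin q → EuclideanSpace ℝ (Fin n)) : State where
  natReg := fun k => if k = 0 then n else if k = 1 then q else 0
  natMem := fun _ => 0
  realReg := fun k => if k = 0 then ε else 0
  realMem := fun k =>
    if h : k < q * n then
      x (finProdFinEquiv.symm ⟨k, h⟩).1 (finProdFinEquiv.symm ⟨k, h⟩).2
    else 0

/-- On the given input the program halts after exactly `t` steps with output `b`, where `true`
(accept) is coded by the value `1`, and `false` (reject) by `0`, in the integer register `0`. -/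
def OutputsIn (P : Prog) (n q : ℕ) (ε : ℝ) (x : Fin q → EuclideanSpace ℝ (Fin n))
    (b : Bool) (t : ℕ) : Prop :=
  ∃ s, Exec P (input n q ε x) t s ∧ s.natReg 0 = b.toNat

/-- The set of sample tuples on which the program halts with output `b`. -/
def outputSet (P : Prog) (n q : ℕ) (ε : ℝ) (b : Bool) :
    Set (Fin q → EuclideanSpace ℝ (Fin n)) :=
  {x | ∃ t, OutputsIn P n q ε x b t}

end RealRAM

/-- The law of `q` i.i.d. samples from the Gaussian with mean `μ` and covariance matrix `S`
on `ℝⁿ`. -/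
def gaussianSamples (n q : ℕ) (μ : EuclideanSpace ℝ (Fin n)) (S : Matrix (Fin n) (Fin n) ℝ) :
    Measure (Fin q → EuclideanSpace ℝ (Fin n)) :=
  Measure.pi fun _ => multivariateGaussian μ S

/-- Gaussian mean testing from `q` samples. Here `pr ν b` is the probability that the procedure
outputs `b` (`true` is accept, `false` is reject) when its sample tuple is drawn from `ν`. -/
def TestsGaussianMean (n q : ℕ) (ε : ℝ)
    (pr : Measure (Fin q → EuclideanSpace ℝ (Fin n)) → Bool → ℝ≥0∞) : Prop :=
  2 / 3 ≤ pr (gaussianSamples n q 0 1) true ∧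
  ∀ (μ : EuclideanSpace ℝ (Fin n)) (S : Matrix (Fin n) (Fin n) ℝ), S.PosSemidef → ε < ‖μ‖ →
    2 / 3 ≤ pr (gaussianSamples n q μ S) false

end

/-! Upper bound. Let `m = q / 2`, and let `X`, `Y` be the sums of `m` samples of even and of odd
index. They are independent Gaussian vectors with common mean `m • μ`, and the test compares `|⟨X,
Y⟩|` with `t = ε² m² / 144`.

Under the standard Gaussian, `⟨X, Y⟩` has second moment `n m²`, so Markov's inequality gives `|⟨X,
Y⟩| ≤ t` with probability at least 2/3 once `m` exceeds a constant times `√n / ε²`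
(`gaussianSamples_lt_abs_inner`).

Under the alternative the covariance is arbitrary and no variance bound is available. Instead, a
real Gaussian of mean `a ≠ 0` has mass at most `2t / |a|` on `[-t, t]`, whatever its variance
(`gaussianReal_abs_le`). Applied first to `⟨X, m • μ⟩` and then, for fixed `X`, to `⟨X, Y⟩`, this
bounds the probability that `⟨X, Y⟩` is small (`IsGaussian.prod_abs_inner_le`).

Lower bound. The standard Gaussian is compared with the uniform mixture of the identity-covariance
Gaussians whose means are the sign vectors of norm `2ε`. The likelihood ratio of the mixture has
second moment `cosh (4qε²/n) ^ n ≤ exp (8 (qε²)² / n)`, while a test with error 1/3 forces this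
moment to be at least 10/9 (`second_moment_of_separates`). Hence `qε²` is at least of order `√n`. -/

/-! ### The program -/

namespace RealRAM

/-- Straight-line programs. -/
def block : List Instr → Prog
  | [] => .skip
  | i :: l => .seq (.instr i) (block l)

theorem exec_block (l : List Instr) (s : State) :
    Exec (block l) s (l.length + 1) (l.foldl (fun s i => i.run s) s) := by
  induction l generalizing s with
  | nil => exact Exec.skip s
  | cons i l ih =>
    rw [List.length_cons, add_right_comm, add_comm _ 1]
    exact Exec.seq (Exec.instr i s) (ih (i.run s))

/-- One pass of the inner loop adds one coordinate of the next two samples to the accumulators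
`2` and `3`, and counts the pass in the accumulator `4`. -/
def innerBody : List Instr :=
  [.realLoad 5 4, .realAdd 2 2 5, .natAdd 4 4 0, .realLoad 5 4, .realAdd 3 3 5, .natAdd 4 4 0,
    .natAdd 3 3 7, .realAdd 4 4 6]

/-- The inner loop runs through all samples, for one coordinate. -/
def innerLoop : Prog := .loop (.natLt 3 1) (block innerBody)

/-- The outer loop runs through all coordinates. -/
def outerLoop : Prog :=
  .loop (.natLt 2 0)
    (.seq (block [.natAdd 4 2 6, .natConst 3 1, .realConst 2 0, .realConst 3 0, .realConst 4 0])
      (.seq innerLoop (block [.realMul 2 2 3, .realAdd 1 1 2, .natAdd 2 2 5])))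

/-- The mean tester: it rejects when the inner product of the sum of the samples of even index with
the sum of the same number `m` of samples of odd index exceeds `ε ^ 2 * m ^ 2 / 144` in
absolute value. -/
def meanTester : Prog :=
  .seq (block [.natConst 5 1, .natConst 7 2, .realConst 6 1])
    (.seq outerLoop
      (.seq (block [.realConst 7 144, .realMul 1 1 7, .realMul 1 1 1, .realMul 0 0 4,
          .realMul 0 0 0, .realMul 0 0 0])
        (.ite (.realLt 0 1) (block [.natConst 0 0]) (block [.natConst 0 1]))))

/-- Here `k` is the number of passes left. The counter in register `3` stays odd and moves by 2;
started at 1, it yields exactly `q / 2` passes, so for odd `q` the last sample is never read. -/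
theorem exec_innerLoop (k : ℕ) : ∀ s : State, s.natReg 1 / 2 = s.natReg 3 / 2 + k →
    s.natReg 3 % 2 = 1 → s.natReg 7 = 2 → s.realReg 6 = 1 →
    ∃ s', Exec innerLoop s (10 * k + 1) s' ∧ s'.realMem = s.realMem ∧
      (∀ r, r ≠ 3 → r ≠ 4 → s'.natReg r = s.natReg r) ∧
      (∀ r, r < 2 ∨ r = 6 → s'.realReg r = s.realReg r) ∧
      s'.realReg 2 = s.realReg 2 +
        ∑ l ∈ Finset.range k, s.realMem (s.natReg 4 + s.natReg 0 * (2 * l)) ∧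
      s'.realReg 3 = s.realReg 3 +
        ∑ l ∈ Finset.range k, s.realMem (s.natReg 4 + s.natReg 0 * (2 * l + 1)) ∧
      s'.realReg 4 = s.realReg 4 + k := by
  induction k with
  | zero =>
    intro s h h' _ _
    have h1 : ¬ (Test.natLt 3 1).Holds s := by simp only [Test.Holds]; omega
    exact ⟨s, Exec.loopFalse h1, rfl, fun _ _ _ => rfl, fun _ _ => rfl, by simp, by simp, by simp⟩
  | succ k ih =>
    intro s h h' h7 h6
    have h1 : (Test.natLt 3 1).Holds s := by simp only [Test.Holds]; omega
    have hb := exec_block innerBody s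
    generalize hs₁ : innerBody.foldl (fun s i => i.run s) s = s₁ at hb
    have hn : ∀ r, r ≠ 3 → r ≠ 4 → s₁.natReg r = s.natReg r := by
      intro r hr hr'
      simp [← hs₁, innerBody, Instr.run, hr, hr']
    have hr : ∀ r, r < 2 ∨ r = 6 → s₁.realReg r = s.realReg r := by
      intro r hr
      rw [← hs₁]
      simp only [innerBody, Instr.run, List.foldl_cons, List.foldl_nil]
      repeat rw [Function.update_of_ne (by omega)]
    have hm : s₁.realMem = s.realMem := by simp [← hs₁, innerBody, Instr.run]
    have h3 : s₁.natReg 3 = s.natReg 3 + 2 := by simp [← hs₁, innerBody, Instr.run, h7]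
    have h4 : s₁.natReg 4 = s.natReg 4 + s.natReg 0 + s.natReg 0 := by
      simp [← hs₁, innerBody, Instr.run]
    have e2 : s₁.realReg 2 = s.realReg 2 + s.realMem (s.natReg 4) := by
      simp [← hs₁, innerBody, Instr.run]
    have e3 : s₁.realReg 3 = s.realReg 3 + s.realMem (s.natReg 4 + s.natReg 0) := by
      simp [← hs₁, innerBody, Instr.run]
    have e4 : s₁.realReg 4 = s.realReg 4 + 1 := by
      simp [← hs₁, innerBody, Instr.run, h6]
    obtain ⟨s', hs', hm', hn', hr', f2, f3, f4⟩ := ih s₁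
      (by rw [hn 1 (by simp) (by simp), h3]; omega) (by omega)
      (by rw [hn 7 (by simp) (by simp), h7]) (by rw [hr 6 (by simp), h6])
    refine ⟨s', ?_, hm'.trans hm, fun r a b => (hn' r a b).trans (hn r a b),
      fun r a => (hr' r a).trans (hr r a), ?_, ?_, ?_⟩
    · have := Exec.loopTrue h1 hb hs'
      rw [show innerBody.length + 1 + (10 * k + 1) + 1 = 10 * (k + 1) + 1 by
        simp [innerBody]; ring] at this
      exact this
    · rw [f2, e2, Finset.sum_range_succ', hm, h4, hn 0 (by simp) (by simp), add_assoc,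
        add_comm (s.realMem _)]
      simp only [mul_zero, add_zero]
      congr 2
      exact Finset.sum_congr rfl fun l _ => by congr 1; ring
    · rw [f3, e3, Finset.sum_range_succ', hm, h4, hn 0 (by simp) (by simp), add_assoc,
        add_comm (s.realMem _)]
      simp only [mul_zero, mul_one, zero_add]
      congr 2
      exact Finset.sum_congr rfl fun l _ => by congr 1; ring
    · rw [f4, e4]; push_cast; ring

/-- Integer register `6` holds 0, so adding it serves as a copy instruction. Integers cannot be
halved, so `m` is obtained by counting inner passes in real register `4`; it is right only after one
coordinate has been processed, hence the condition for `k = 0`. -/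
theorem exec_outerLoop (m k : ℕ) : ∀ s : State, s.natReg 1 / 2 = m →
    s.natReg 0 = s.natReg 2 + k → s.natReg 5 = 1 → s.natReg 6 = 0 → s.natReg 7 = 2 →
    s.realReg 6 = 1 → (k = 0 → s.realReg 4 = m) →
    ∃ s', Exec outerLoop s ((10 * m + 12) * k + 1) s' ∧ s'.realReg 0 = s.realReg 0 ∧
      s'.realReg 4 = m ∧
      s'.realReg 1 = s.realReg 1 + ∑ j ∈ Finset.range k,
        (∑ l ∈ Finset.range m, s.realMem (s.natReg 2 + j + s.natReg 0 * (2 * l))) *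
        (∑ l ∈ Finset.range m, s.realMem (s.natReg 2 + j + s.natReg 0 * (2 * l + 1))) := by
  induction k with
  | zero =>
    intro s _ h0 _ _ _ _ h4
    have h1 : ¬ (Test.natLt 2 0).Holds s := by simp only [Test.Holds]; omega
    exact ⟨s, Exec.loopFalse h1, rfl, h4 rfl, by simp⟩
  | succ k ih =>
    intro s hm h0 h5 h6 h7 g6 _
    have h1 : (Test.natLt 2 0).Holds s := by simp only [Test.Holds]; omega
    have hb := exec_block
      [.natAdd 4 2 6, .natConst 3 1, .realConst 2 0, .realConst 3 0, .realConst 4 0] s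
    simp only [Instr.run, List.foldl_cons, List.foldl_nil, h6, List.length_cons,
      List.length_nil] at hb
    generalize hs₁ : State.mk _ _ _ _ = s₁ at hb
    obtain ⟨s₂, hs₂, hm₂, hn₂, hr₂, f2, f3, f4⟩ := exec_innerLoop m s₁
      (by simpa [← hs₁] using hm) (by simp [← hs₁]) (by simpa [← hs₁] using h7)
      (by simpa [← hs₁] using g6)
    have hc := exec_block [.realMul 2 2 3, .realAdd 1 1 2, .natAdd 2 2 5] s₂
    simp only [Instr.run, List.foldl_cons, List.foldl_nil, List.length_cons,
      List.length_nil] at hc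
    generalize hs₃ : State.mk _ _ _ _ = s₃ at hc
    have a : ∀ r, r ≠ 2 → r ≠ 3 → r ≠ 4 → s₃.natReg r = s.natReg r := by
      intro r h2 h3 h4
      simp [← hs₃, hn₂ r h3 h4, ← hs₁, h2, h3, h4]
    have a2 : s₃.natReg 2 = s.natReg 2 + 1 := by
      simp [← hs₃, hn₂, ← hs₁, h5]
    have b0 : s₃.realReg 0 = s.realReg 0 := by
      simp [← hs₃, hr₂, ← hs₁]
    have b6 : s₃.realReg 6 = 1 := by
      simp [← hs₃, hr₂, ← hs₁, g6]
    have b4 : s₃.realReg 4 = m := by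
      simp [← hs₃, f4, ← hs₁]
    have bm : s₃.realMem = s.realMem := by
      simp [← hs₃, hm₂, ← hs₁]
    have b1 : s₃.realReg 1 = s.realReg 1 +
        (∑ l ∈ Finset.range m, s.realMem (s.natReg 2 + s.natReg 0 * (2 * l))) *
        (∑ l ∈ Finset.range m, s.realMem (s.natReg 2 + s.natReg 0 * (2 * l + 1))) := by
      simp [← hs₃, hr₂, f2, f3, ← hs₁]
    obtain ⟨s', hs', e0, e4, e1⟩ := ih s₃ (by rw [a 1 (by simp) (by simp) (by simp), hm])
      (by rw [a 0 (by simp) (by simp) (by simp), a2]; omega)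
      (by rw [a 5 (by simp) (by simp) (by simp), h5])
      (by rw [a 6 (by simp) (by simp) (by simp), h6])
      (by rw [a 7 (by simp) (by simp) (by simp), h7]) b6 (fun _ => b4)
    refine ⟨s', ?_, e0.trans b0, e4, ?_⟩
    · have := Exec.loopTrue h1 (hb.seq (hs₂.seq hc)) hs'
      convert! this using 1
      ring
    · rw [e1, b1, Finset.sum_range_succ', bm, a2, a 0 (by simp) (by simp) (by simp), add_assoc]
      congr 1
      rw [add_comm]
      simp only [add_zero, add_assoc, add_comm 1]

/-- The value of the test statistic, in terms of the input memory. -/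
theorem exec_meanTester (s : State) (h0 : 1 ≤ s.natReg 0) (h2 : s.natReg 2 = 0)
    (h6 : s.natReg 6 = 0) (g1 : s.realReg 1 = 0) :
    ∃ s', Exec meanTester s ((10 * (s.natReg 1 / 2) + 12) * s.natReg 0 + 15) s' ∧
      s'.natReg 0 = if (s.realReg 0 * (s.natReg 1 / 2 : ℕ)) ^ 4 <
        ((∑ j ∈ Finset.range (s.natReg 0),
          (∑ l ∈ Finset.range (s.natReg 1 / 2), s.realMem (j + s.natReg 0 * (2 * l))) *
          (∑ l ∈ Finset.range (s.natReg 1 / 2), s.realMem (j + s.natReg 0 * (2 * l + 1)))) *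
            144) ^ 2 then 0 else 1 := by
  have hb := exec_block [.natConst 5 1, .natConst 7 2, .realConst 6 1] s
  simp only [Instr.run, List.foldl_cons, List.foldl_nil, List.length_cons,
    List.length_nil] at hb
  generalize hs₁ : State.mk _ _ _ _ = s₁ at hb
  obtain ⟨s₂, hs₂, e0, e4, e1⟩ := exec_outerLoop (s.natReg 1 / 2) (s.natReg 0) s₁
    (by simp [← hs₁]) (by simp [← hs₁, h2]) (by simp [← hs₁]) (by simp [← hs₁, h6])
    (by simp [← hs₁]) (by simp [← hs₁]) (by omega)
  have hc := exec_block [.realConst 7 144, .realMul 1 1 7, .realMul 1 1 1, .realMul 0 0 4,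
    .realMul 0 0 0, .realMul 0 0 0] s₂
  simp only [Instr.run, List.foldl_cons, List.foldl_nil, List.length_cons,
    List.length_nil] at hc
  generalize hs₃ : State.mk _ _ _ _ = s₃ at hc
  have c0 : s₃.realReg 0 = (s.realReg 0 * (s.natReg 1 / 2 : ℕ)) ^ 4 := by
    simp only [← hs₃, ne_eq, Nat.reduceEqDiff, not_false_eq_true, Function.update_of_ne,
      Function.update_self, e0, e4, zero_ne_one, OfNat.zero_ne_ofNat]
    simp [← hs₁]
    ring
  have c1 : s₃.realReg 1 = ((∑ j ∈ Finset.range (s.natReg 0),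
          (∑ l ∈ Finset.range (s.natReg 1 / 2), s.realMem (j + s.natReg 0 * (2 * l))) *
          (∑ l ∈ Finset.range (s.natReg 1 / 2), s.realMem (j + s.natReg 0 * (2 * l + 1)))) *
            144) ^ 2 := by
    simp only [← hs₃, ne_eq, Nat.reduceEqDiff, not_false_eq_true, Function.update_of_ne,
      Function.update_self, e1, zero_ne_one, one_ne_zero, OfNat.ofNat_ne_one,
      OfNat.one_ne_ofNat]
    simp [← hs₁, g1, h2]
    ring
  clear hs₃
  rw [← c0, ← c1]
  split_ifs with h
  · refine ⟨(Instr.natConst 0 0).run s₃, ?_, by simp [Instr.run]⟩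
    have := hb.seq (hs₂.seq (hc.seq (Exec.iteTrue (c := .realLt 0 1) (Q := block [.natConst 0 1]) h
      (exec_block [.natConst 0 0] s₃))))
    convert! this using 1
    simp
    ring
  · refine ⟨(Instr.natConst 0 1).run s₃, ?_, by simp [Instr.run]⟩
    have := hb.seq (hs₂.seq (hc.seq (Exec.iteFalse (c := .realLt 0 1) (P := block [.natConst 0 0]) h
      (exec_block [.natConst 0 1] s₃))))
    convert! this using 1
    simp
    ring

/-- The index `2 * l + e` of a sample. -/
def sampleIndex {q : ℕ} (e : Fin 2) (l : Fin (q / 2)) : Fin q := ⟨2 * l + e, by omega⟩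

/-- The sum of the samples with indices `2 * l + e`, for `l < q / 2`. -/
noncomputable def paritySum {n q : ℕ} (e : Fin 2) (x : Fin q → EuclideanSpace ℝ (Fin n)) :
    EuclideanSpace ℝ (Fin n) :=
  ∑ l : Fin (q / 2), x (sampleIndex e l)

theorem input_realMem {n q : ℕ} {ε : ℝ} {x : Fin q → EuclideanSpace ℝ (Fin n)} (i : Fin q)
    (j : Fin n) : (input n q ε x).realMem (j + n * i) = x i j := by
  have h : (finProdFinEquiv.symm ⟨j + n * i, (finProdFinEquiv (i, j)).2⟩ : Fin q × Fin n) = (i, j) :=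
    finProdFinEquiv.symm_apply_apply (i, j)
  have hlt : (j + n * i : ℕ) < q * n := (finProdFinEquiv (i, j)).2
  simp only [input, dif_pos hlt, h]

theorem sum_input_realMem {n q : ℕ} {ε : ℝ} {x : Fin q → EuclideanSpace ℝ (Fin n)} (e : Fin 2)
    (j : Fin n) :
    ∑ l ∈ Finset.range (q / 2), (input n q ε x).realMem (j + n * (2 * l + e)) =
      paritySum e x j := by
  rw [paritySum, WithLp.ofLp_sum, Finset.sum_apply, Finset.sum_range]
  exact Finset.sum_congr rfl fun l _ => input_realMem (sampleIndex e l) j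

theorem meanTester_outputsIn {n q : ℕ} {ε : ℝ} (hn : 1 ≤ n)
    (x : Fin q → EuclideanSpace ℝ (Fin n)) :
    OutputsIn meanTester n q ε x
      (decide (¬ (ε * (q / 2 : ℕ)) ^ 4 < (inner ℝ (paritySum 0 x) (paritySum 1 x) * 144) ^ 2))
      ((10 * (q / 2) + 12) * n + 15) := by
  obtain ⟨s', hs', h'⟩ := exec_meanTester (input n q ε x) (by simpa [input] using hn)
    (by simp [input]) (by simp [input]) (by simp [input])
  have h0 : (input n q ε x).natReg 0 = n := rfl
  have h1 : (input n q ε x).natReg 1 = q := rfl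
  have h2 : (input n q ε x).realReg 0 = ε := rfl
  rw [h0, h1] at hs'
  refine ⟨s', hs', ?_⟩
  have e0 := fun j => sum_input_realMem (ε := ε) (x := x) 0 j
  have e1 := fun j => sum_input_realMem (ε := ε) (x := x) 1 j
  simp only [Fin.val_zero, add_zero, Fin.val_one] at e0 e1
  rw [h', h0, h1, h2, Finset.sum_range]
  simp only [e0, e1]
  rw [PiLp.inner_apply]
  simp only [RCLike.inner_apply, conj_trivial, mul_comm]
  split_ifs <;> simp_all

/-- Determinism (`Exec.unique`) excludes any output other than that of the run already exhibited. -/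
theorem outputSet_meanTester {n q : ℕ} {ε : ℝ} (hn : 1 ≤ n) (b : Bool) :
    outputSet meanTester n q ε b = {x | decide (¬ (ε * (q / 2 : ℕ)) ^ 4 <
      (inner ℝ (paritySum 0 x) (paritySum 1 x) * 144) ^ 2) = b} := by
  ext x
  refine ⟨fun ⟨t, s, hs, hb⟩ => ?_, fun h => ⟨_, h ▸ meanTester_outputsIn hn x⟩⟩
  obtain ⟨s', hs', hb'⟩ := meanTester_outputsIn (ε := ε) hn x
  obtain ⟨_, rfl⟩ := hs.unique hs'
  have h := hb'.symm.trans hb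
  change decide _ = b
  revert h
  cases decide (¬ (ε * (q / 2 : ℕ)) ^ 4 < (inner ℝ (paritySum 0 x) (paritySum 1 x) * 144) ^ 2) <;>
    cases b <;> simp

end RealRAM

/-! ### Running time -/

theorem le_three_mul_rpow_log {n : ℕ} (hn : 1 ≤ n) : (n : ℝ) ≤ 3 * (n : ℝ) ^ Real.log n := by
  have hn' : (0 : ℝ) < n := by positivity
  have h : (n : ℝ) = Real.exp (Real.log n) := (Real.exp_log hn').symm
  have h1 : Real.log n ≤ 1 + Real.log n * Real.log n := by nlinarith [sq_nonneg (Real.log n - 1/2)]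
  calc (n : ℝ) = Real.exp (Real.log n) := h
    _ ≤ Real.exp (1 + Real.log n * Real.log n) := Real.exp_le_exp.2 h1
    _ = Real.exp 1 * (n : ℝ) ^ Real.log n := by rw [Real.exp_add, Real.rpow_def_of_pos hn']
    _ ≤ 3 * (n : ℝ) ^ Real.log n := by
      gcongr
      exact (Real.exp_one_lt_d9.trans (by norm_num)).le

theorem meanTester_time_le {n : ℕ} (q : ℕ) (hn : 1 ≤ n) :
    (((10 * (q / 2) + 12) * n + 15 : ℕ) : ℝ) ≤
      (100 : ℕ) * ((q : ℝ) + (n : ℝ) ^ Real.log n) ^ 100 := by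
  have h := le_three_mul_rpow_log hn
  set N := (n : ℝ) ^ Real.log n
  have hN : 1 ≤ N := Real.one_le_rpow (by exact_mod_cast hn) (Real.log_natCast_nonneg n)
  have hq : ((q / 2 : ℕ) : ℝ) ≤ q / 2 := Nat.cast_div_le
  have hq0 : (0 : ℝ) ≤ q := by positivity
  have hp : ((q : ℝ) + N) ^ 2 ≤ (q + N) ^ 100 := pow_le_pow_right₀ (by linarith) (by norm_num)
  push_cast
  calc (10 * ((q / 2 : ℕ) : ℝ) + 12) * n + 15 ≤ (10 * (q / 2) + 12) * (3 * N) + 15 := by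
        gcongr
    _ ≤ 100 * (q + N) ^ 2 := by nlinarith
    _ ≤ 100 * (q + N) ^ 100 := by gcongr

/-! ### Anti-concentration -/

/-- If `2t < |a|`, points of `[-t, t]` lie at distance at least `|a| / 2` from the mean. There the
density is at most `1 / |a|` for every `v > 0`: a large variance makes the prefactor small, a small
one the exponential. -/
theorem gaussianReal_abs_le {a : ℝ} (v : NNReal) {t : ℝ} (ha : a ≠ 0) :
    gaussianReal a v {x | |x| ≤ t} ≤ ENNReal.ofReal (2 * t / |a|) := by
  have ha' : 0 < |a| := abs_pos.2 ha
  rcases le_or_gt |a| (2 * t) with h | h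
  · refine prob_le_one.trans ?_
    rw [← ENNReal.ofReal_one]
    exact ENNReal.ofReal_le_ofReal ((one_le_div ha').2 h)
  -- Zero variance is a Dirac mass at `a`, which lies outside the interval.
  rcases eq_or_ne v 0 with rfl | hv
  · rw [gaussianReal_zero_var, Measure.dirac_apply' _ (measurableSet_le (by fun_prop) (by fun_prop)),
      Set.indicator_of_notMem]
    · exact zero_le
    · simp only [Set.mem_ofPred_eq, not_le]
      linarith
  have hset : {x : ℝ | |x| ≤ t} = Set.Icc (-t) t := by ext; simp [abs_le]
  rw [hset, gaussianReal_apply a hv]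
  have hpdf : ∀ x ∈ Set.Icc (-t) t, gaussianPDF a v x ≤ ENNReal.ofReal (1 / |a|) := by
    intro x hx
    refine ENNReal.ofReal_le_ofReal ?_
    have hv' : (0 : ℝ) < v := lt_of_le_of_ne v.2 (by exact_mod_cast hv.symm)
    have hx' : |a| / 2 ≤ |x - a| := by
      have := abs_sub_abs_le_abs_sub a x
      rw [abs_sub_comm a x] at this
      have := abs_le.2 hx
      linarith
    have hsq : a ^ 2 / 4 ≤ (x - a) ^ 2 := by
      rw [← sq_abs (x - a), ← sq_abs a]
      nlinarith
    have hs : 0 < √(v : ℝ) := Real.sqrt_pos.2 hv'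
    have hs2 : √(v : ℝ) ^ 2 = v := Real.sq_sqrt hv'.le
    rw [gaussianPDFReal_def]
    simp only
    -- Uses `2π ≥ 4` and `exp (-y) ≤ 1 / (1 + y)`; what remains is of AM-GM type in `√v`.
    calc (√(2 * Real.pi * v))⁻¹ * Real.exp (-(x - a) ^ 2 / (2 * v))
        ≤ (2 * √(v : ℝ))⁻¹ * (1 + a ^ 2 / (8 * v))⁻¹ := by
          gcongr
          · refine Real.le_sqrt_of_sq_le ?_
            rw [mul_pow, hs2]
            nlinarith [Real.pi_gt_three]
          · rw [show -(x - a) ^ 2 / (2 * v) = -((x - a) ^ 2 / (2 * v)) by ring, Real.exp_neg]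
            gcongr
            refine le_trans ?_ (Real.add_one_le_exp _)
            rw [add_comm]
            refine add_le_add ?_ le_rfl
            rw [div_le_div_iff₀ (by positivity) (by positivity)]
            nlinarith
      _ ≤ 1 / |a| := by
          rw [← mul_inv, one_div]
          gcongr
          have e : 2 * √(v : ℝ) * (1 + a ^ 2 / (8 * v)) = 2 * √(v : ℝ) + |a| ^ 2 / (4 * √(v : ℝ)) := by
            rw [sq_abs]
            generalize √(v : ℝ) = w at hs hs2
            rw [← hs2]
            field_simp
            ring
          rw [e, ← sub_nonneg]
          have : 2 * √(v : ℝ) + |a| ^ 2 / (4 * √(v : ℝ)) - |a| =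
            ((|a| - 2 * √(v : ℝ)) ^ 2 + 4 * √(v : ℝ) ^ 2) / (4 * √(v : ℝ)) := by
            field_simp
            ring
          rw [this]
          positivity
  calc ∫⁻ x in Set.Icc (-t) t, gaussianPDF a v x
      ≤ ∫⁻ _ in Set.Icc (-t) t, ENNReal.ofReal (1 / |a|) :=
        setLIntegral_mono' measurableSet_Icc hpdf
    _ = ENNReal.ofReal (2 * t / |a|) := by
        rw [setLIntegral_const, Real.volume_Icc, ← ENNReal.ofReal_mul (by positivity)]
        congr 1
        ring

section

variable {E : Type*} [NormedAddCommGroup E] [InnerProductSpace ℝ E] [FiniteDimensional ℝ E]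
  [MeasurableSpace E] [BorelSpace E]

theorem IsGaussian.abs_inner_le (ρ : Measure E) [IsGaussian ρ] (y : E) {t : ℝ}
    (h : inner ℝ y (∫ x, x ∂ρ) ≠ 0) :
    ρ {x | |inner ℝ y x| ≤ t} ≤ ENNReal.ofReal (2 * t / |inner ℝ y (∫ x, x ∂ρ)|) := by
  have hm : MeasurableSet {r : ℝ | |r| ≤ t} := measurableSet_le (by fun_prop) (by fun_prop)
  have h1 := IsGaussian.map_eq_gaussianReal (μ := ρ) (innerSL ℝ y)
  have h2 : ∫ x, innerSL ℝ y x ∂ρ = inner ℝ y (∫ x, x ∂ρ) := by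
    rw [(innerSL ℝ y).integral_comp_comm IsGaussian.integrable_fun_id]
    rfl
  rw [h2] at h1
  have := gaussianReal_abs_le (Var[innerSL ℝ y; ρ]).toNNReal (t := t) h
  rw [← h1, Measure.map_apply (by fun_prop) hm] at this
  exact this

/-- Outside an event of probability at most `2δ`, `⟨M, x⟩` exceeds `δ ‖M‖²` in absolute value; for
each such `x`, `⟨x, ·⟩` is Gaussian under `ρ'` with mean `⟨x, M⟩`, so one-dimensional
anti-concentration applies again. -/
theorem IsGaussian.prod_abs_inner_le (ρ ρ' : Measure E) [IsGaussian ρ] [IsGaussian ρ'] {M : E}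
    (hρ : ∫ x, x ∂ρ = M) (hρ' : ∫ x, x ∂ρ' = M) (hM : M ≠ 0) {t δ : ℝ} (hδ : 0 < δ) (ht : 0 ≤ t) :
    (ρ.prod ρ') {z | |inner ℝ z.1 z.2| ≤ t} ≤
      ENNReal.ofReal (2 * δ) + ENNReal.ofReal (2 * t / (δ * ‖M‖ ^ 2)) := by
  have hM' : 0 < ‖M‖ ^ 2 := by have := norm_pos_iff.2 hM; positivity
  have hm : MeasurableSet {z : E × E | |inner ℝ z.1 z.2| ≤ t} :=
    measurableSet_le (by fun_prop) (by fun_prop)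
  have hA : MeasurableSet {x : E | |inner ℝ M x| ≤ δ * ‖M‖ ^ 2} :=
    measurableSet_le (by fun_prop) (by fun_prop)
  set c := ENNReal.ofReal (2 * t / (δ * ‖M‖ ^ 2))
  rw [Measure.prod_apply hm]
  calc ∫⁻ x, ρ' (Prod.mk x ⁻¹' {z | |inner ℝ z.1 z.2| ≤ t}) ∂ρ
      ≤ ∫⁻ x, ({x : E | |inner ℝ M x| ≤ δ * ‖M‖ ^ 2}.indicator 1 x + c) ∂ρ := by
        refine lintegral_mono fun x => ?_
        by_cases hx : |inner ℝ M x| ≤ δ * ‖M‖ ^ 2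
        · rw [Set.indicator_of_mem (by exact hx)]
          exact prob_le_one.trans (by simp)
        · rw [Set.indicator_of_notMem (by exact hx), zero_add]
          rw [not_le, real_inner_comm] at hx
          have hp : 0 < δ * ‖M‖ ^ 2 := by positivity
          have h0 : inner ℝ x (∫ y, y ∂ρ') ≠ 0 := by
            rw [hρ']; exact abs_pos.1 (hp.trans hx)
          refine (IsGaussian.abs_inner_le ρ' x h0).trans (ENNReal.ofReal_le_ofReal ?_)
          rw [hρ']
          gcongr
    _ = ρ {x : E | |inner ℝ M x| ≤ δ * ‖M‖ ^ 2} + c := by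
        rw [lintegral_add_right _ measurable_const, lintegral_indicator_one hA]
        simp
    _ ≤ ENNReal.ofReal (2 * δ) + c := by
        gcongr
        have h0 : inner ℝ M (∫ x, x ∂ρ) = ‖M‖ ^ 2 := by rw [hρ, real_inner_self_eq_norm_sq]
        refine (IsGaussian.abs_inner_le ρ M (h0 ▸ hM'.ne')).trans (ENNReal.ofReal_le_ofReal ?_)
        rw [h0, abs_of_pos hM']
        apply le_of_eq
        field_simp

end

/-! ### The law of the test statistic -/

namespace RealRAM

variable {n q : ℕ}

theorem sampleIndex_injective (e : Fin 2) :
    Function.Injective (sampleIndex e : Fin (q / 2) → Fin q) := by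
  intro a b h
  simp only [sampleIndex, Fin.mk.injEq] at h
  omega

@[fun_prop]
theorem measurable_paritySum (e : Fin 2) :
    Measurable (paritySum e : (Fin q → EuclideanSpace ℝ (Fin n)) → _) := by
  unfold paritySum
  fun_prop

section

variable (ν : Measure (EuclideanSpace ℝ (Fin n)))

theorem iIndepFun_sample [IsProbabilityMeasure ν] :
    iIndepFun (fun (i : Fin q) (x : Fin q → EuclideanSpace ℝ (Fin n)) => x i)
      (Measure.pi fun _ => ν) :=
  iIndepFun_pi (X := fun _ => id) fun _ => aemeasurable_id

/-- The two sums are functions of disjoint blocks of independent samples. -/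
theorem indepFun_paritySum [IsProbabilityMeasure ν] :
    IndepFun (paritySum 0) (paritySum 1)
      (Measure.pi fun _ : Fin q => ν) := by
  have h := (iIndepFun_sample (q := q) ν).indepFun_finset
    (Finset.univ.filter fun i => i.val % 2 = 0) (Finset.univ.filter fun i => i.val % 2 = 1)
    (Finset.disjoint_filter.2 fun i _ h => by omega) (fun i => measurable_pi_apply i)
  exact h.comp
    (φ := fun y => ∑ l : Fin (q / 2), y ⟨sampleIndex 0 l, by simp [sampleIndex]⟩)
    (ψ := fun y => ∑ l : Fin (q / 2), y ⟨sampleIndex 1 l, by simp [sampleIndex, Nat.add_mod]⟩)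
    (Finset.measurable_sum _ fun l _ => measurable_pi_apply _)
    (Finset.measurable_sum _ fun l _ => measurable_pi_apply _)

theorem hasGaussianLaw_paritySum [IsGaussian ν] (e : Fin 2) :
    HasGaussianLaw (paritySum e) (Measure.pi fun _ : Fin q => ν) := by
  refine iIndepFun.hasGaussianLaw_fun_sum
    (X := fun (l : Fin (q / 2)) (x : Fin q → EuclideanSpace ℝ (Fin n)) => x (sampleIndex e l))
    (fun l => ?_) ?_
  · exact (measurePreserving_eval (fun _ : Fin q => ν) _).hasLaw.hasGaussianLaw
  · refine (iIndepFun_sample (q := q) ν).precomp (g := sampleIndex e)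
      (sampleIndex_injective e)

theorem integral_paritySum [IsGaussian ν] (e : Fin 2) :
    ∫ x, paritySum e x ∂(Measure.pi fun _ : Fin q => ν) = ((q / 2 : ℕ) : ℝ) • ∫ x, x ∂ν := by
  unfold paritySum
  rw [integral_finsetSum]
  · simp_rw [integral_eval]
    simp [Nat.cast_smul_eq_nsmul]
  · exact fun l _ => integrable_eval IsGaussian.integrable_id

/-- The mean vanishes, so this is a variance: `q / 2` independent terms contribute `‖v‖²` each. -/
theorem lintegral_inner_paritySum_sq (e : Fin 2) (v : EuclideanSpace ℝ (Fin n)) :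
    ∫⁻ x, ENNReal.ofReal (inner ℝ v (paritySum e x) ^ 2)
      ∂(Measure.pi fun _ : Fin q => stdGaussian (EuclideanSpace ℝ (Fin n))) =
      ENNReal.ofReal ((q / 2 : ℕ) * ‖v‖ ^ 2) := by
  set ν := stdGaussian (EuclideanSpace ℝ (Fin n))
  have hG := (hasGaussianLaw_paritySum (q := q) ν e).map_fun (innerSL ℝ v)
  have hmean : ∫ x, innerSL ℝ v (paritySum e x) ∂(Measure.pi fun _ : Fin q => ν) = 0 := by
    rw [(innerSL ℝ v).integral_comp_comm (hasGaussianLaw_paritySum (q := q) ν e).integrable,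
      integral_paritySum]
    simp [ν]
  have hX (l : Fin (q / 2)) : HasGaussianLaw
      (fun x : Fin q → EuclideanSpace ℝ (Fin n) => innerSL ℝ v (x (sampleIndex e l)))
      (Measure.pi fun _ : Fin q => ν) :=
    (measurePreserving_eval (fun _ : Fin q => ν) _).hasLaw.hasGaussianLaw.map_fun (innerSL ℝ v)
  have hvar : Var[fun x => innerSL ℝ v (paritySum e x); Measure.pi fun _ : Fin q => ν] =
      (q / 2 : ℕ) * ‖v‖ ^ 2 := by
    have : (fun x : Fin q → EuclideanSpace ℝ (Fin n) => innerSL ℝ v (paritySum e x)) =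
        ∑ l : Fin (q / 2), fun x => innerSL ℝ v (x (sampleIndex e l)) := by
      ext x
      simp only [paritySum, map_sum, Finset.sum_apply]
    rw [this, IndepFun.variance_sum (fun l _ => (hX l).memLp_two)]
    · have hl (l : Fin (q / 2)) : Var[fun x : Fin q → EuclideanSpace ℝ (Fin n) =>
          innerSL ℝ v (x (sampleIndex e l)); Measure.pi fun _ : Fin q => ν] = ‖v‖ ^ 2 := by
        have hp := measurePreserving_eval (fun _ : Fin q => ν) (sampleIndex e l)
        have := variance_map (X := innerSL ℝ v) (Y := Function.eval (sampleIndex e l))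
          (μ := Measure.pi fun _ : Fin q => ν) (by fun_prop)
          (measurable_pi_apply _).aemeasurable
        rw [hp.map_eq, variance_dual_stdGaussian, innerSL_apply_norm] at this
        exact this.symm
      rw [Finset.sum_congr rfl fun l _ => hl l]
      simp
    · intro a _ b _ hab
      refine ((iIndepFun_sample (q := q) ν).indepFun (i := sampleIndex e a)
        (j := sampleIndex e b) ?_).comp (φ := innerSL ℝ v) (ψ := innerSL ℝ v)
        (by fun_prop) (by fun_prop)
      exact (sampleIndex_injective e).ne hab
  rw [← hvar, ofReal_variance hG.memLp_two, evariance_eq_lintegral_ofReal, hmean]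
  simp

end

/-- The joint law of the two sums is a product. -/
theorem gaussianSamples_paritySum {μ : EuclideanSpace ℝ (Fin n)} {S : Matrix (Fin n) (Fin n) ℝ}
    {A : Set (EuclideanSpace ℝ (Fin n) × EuclideanSpace ℝ (Fin n))} (hA : MeasurableSet A) :
    gaussianSamples n q μ S {x | (paritySum 0 x, paritySum 1 x) ∈ A} =
      ((gaussianSamples n q μ S).map (paritySum 0)).prod
        ((gaussianSamples n q μ S).map (paritySum 1)) A := by
  have h := (indepFun_iff_map_prod_eq_prod_map_map (by fun_prop) (by fun_prop)).1
    (indepFun_paritySum (q := q) (multivariateGaussian μ S))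
  rw [gaussianSamples, ← h, Measure.map_apply (by fun_prop) hA]
  rfl

theorem gaussianSamples_abs_inner_le {μ : EuclideanSpace ℝ (Fin n)}
    {S : Matrix (Fin n) (Fin n) ℝ} (hq : 2 ≤ q) {ε : ℝ} (hε : 0 < ε) (hμ : ε < ‖μ‖) :
    gaussianSamples n q μ S
      {x | |inner ℝ (paritySum 0 x) (paritySum 1 x)| ≤ (ε * (q / 2 : ℕ)) ^ 2 / 144} ≤ 1 / 3 := by
  have hm : 0 < ((q / 2 : ℕ) : ℝ) := by
    have : 0 < q / 2 := by omega
    exact_mod_cast this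
  have hμ0 : 0 < ‖μ‖ := hε.trans hμ
  have hmean (e : Fin 2) : ∫ x, x ∂((gaussianSamples n q μ S).map (paritySum e)) =
      ((q / 2 : ℕ) : ℝ) • μ := by
    rw [integral_map (by fun_prop) (by fun_prop), gaussianSamples, integral_paritySum,
      integral_id_multivariateGaussian]
  have (e : Fin 2) : IsGaussian ((gaussianSamples n q μ S).map (paritySum e)) :=
    (hasGaussianLaw_paritySum (q := q) (multivariateGaussian μ S) e).isGaussian_map
  have h := gaussianSamples_paritySum (q := q) (μ := μ) (S := S)
    (A := {z | |inner ℝ z.1 z.2| ≤ (ε * (q / 2 : ℕ)) ^ 2 / 144})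
    (measurableSet_le (by fun_prop) (by fun_prop))
  -- With `δ = 1 / 12` and threshold constant `144 = 12²`, both error terms are at most 1/6.
  refine h.trans_le ((IsGaussian.prod_abs_inner_le _ _ (hmean 0) (hmean 1)
    (smul_ne_zero hm.ne' (norm_pos_iff.1 hμ0)) (δ := 1 / 12) (by norm_num) (by positivity)).trans ?_)
  rw [← ENNReal.ofReal_add (by positivity) (by positivity), norm_smul, Real.norm_of_nonneg hm.le]
  have h3 : (1 / 3 : ℝ≥0∞) = ENNReal.ofReal (1 / 3) := by
    rw [ENNReal.ofReal_div_of_pos (by norm_num)]; simp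
  rw [h3]
  refine ENNReal.ofReal_le_ofReal ?_
  have : 2 * ((ε * (q / 2 : ℕ)) ^ 2 / 144) / (1 / 12 * (((q / 2 : ℕ) : ℝ) * ‖μ‖) ^ 2) ≤ 1 / 6 := by
    rw [div_le_iff₀ (by positivity), mul_pow, mul_pow]
    have : ε ^ 2 ≤ ‖μ‖ ^ 2 := by gcongr
    have := mul_le_mul_of_nonneg_right this (sq_nonneg ((q / 2 : ℕ) : ℝ))
    linarith
  linarith

/-- Markov's inequality for `⟨X, Y⟩²`. Integrating over `Y` first leaves `m ‖X‖²`, and expanding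
`‖X‖²` in an orthonormal basis gives `n m²` in total. -/
theorem gaussianSamples_lt_abs_inner {t : ℝ} (ht : 0 < t)
    (h : 3 * (n * ((q / 2 : ℕ) : ℝ) ^ 2) ≤ t ^ 2) :
    gaussianSamples n q 0 1 {x | t < |inner ℝ (paritySum 0 x) (paritySum 1 x)|} ≤ 1 / 3 := by
  have hs := gaussianSamples_paritySum (n := n) (q := q) (μ := 0) (S := 1)
    (A := {z | t < |inner ℝ z.1 z.2|}) (measurableSet_lt (by fun_prop) (by fun_prop))
  refine hs.trans_le ?_
  set m : ℝ := ((q / 2 : ℕ) : ℝ) with hm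
  have hmom (e : Fin 2) (v : EuclideanSpace ℝ (Fin n)) :
      ∫⁻ y, ENNReal.ofReal (inner ℝ v y ^ 2) ∂((gaussianSamples n q 0 1).map (paritySum e)) =
        ENNReal.ofReal (m * ‖v‖ ^ 2) := by
    rw [lintegral_map (by fun_prop) (by fun_prop), gaussianSamples, multivariateGaussian_zero_one,
      lintegral_inner_paritySum_sq]
  have (e : Fin 2) : IsProbabilityMeasure ((gaussianSamples n q 0 1).map (paritySum e)) :=
    (hasGaussianLaw_paritySum (q := q) (multivariateGaussian 0 1) e).isGaussian_map.toIsProbabilityMeasure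
  set ρ := (gaussianSamples n q 0 1).map (paritySum (n := n) (q := q) 0)
  set ρ' := (gaussianSamples n q 0 1).map (paritySum (n := n) (q := q) 1)
  have hsecond : ∫⁻ z, ENNReal.ofReal (inner ℝ z.1 z.2 ^ 2) ∂(ρ.prod ρ') =
      ENNReal.ofReal (n * m ^ 2) := by
    rw [lintegral_prod _ (by fun_prop)]
    simp only [ρ', hmom 1]
    have (x : EuclideanSpace ℝ (Fin n)) : ENNReal.ofReal (m * ‖x‖ ^ 2) = ENNReal.ofReal m *
        ∑ j, ENNReal.ofReal (inner ℝ (EuclideanSpace.basisFun (Fin n) ℝ j) x ^ 2) := by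
      rw [ENNReal.ofReal_mul (by positivity), ← ENNReal.ofReal_sum_of_nonneg fun _ _ => sq_nonneg _,
        (EuclideanSpace.basisFun (Fin n) ℝ).sum_sq_inner_right]
    simp only [this]
    rw [lintegral_const_mul _ (by fun_prop), lintegral_finsetSum _ (by fun_prop)]
    simp only [ρ, hmom 0, OrthonormalBasis.norm_eq_one, one_pow, mul_one, Finset.sum_const,
      Finset.card_univ, Fintype.card_fin, nsmul_eq_mul]
    rw [← ENNReal.ofReal_natCast n, ← ENNReal.ofReal_mul (by positivity),
      ← ENNReal.ofReal_mul (by positivity)]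
    congr 1
    ring
  have hmarkov := mul_meas_ge_le_lintegral₀ (μ := ρ.prod ρ')
    (f := fun z => ENNReal.ofReal (inner ℝ z.1 z.2 ^ 2)) (by fun_prop) (ENNReal.ofReal (t ^ 2))
  rw [hsecond] at hmarkov
  have ht2 : ENNReal.ofReal (t ^ 2) ≠ 0 := by simp; positivity
  calc (ρ.prod ρ') {z | t < |inner ℝ z.1 z.2|}
      ≤ (ρ.prod ρ') {z | ENNReal.ofReal (t ^ 2) ≤ ENNReal.ofReal (inner ℝ z.1 z.2 ^ 2)} := by
        refine measure_mono fun z hz => ENNReal.ofReal_le_ofReal ?_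
        rw [← sq_abs (inner ℝ z.1 z.2)]
        have : t < |inner ℝ z.1 z.2| := hz
        gcongr
    _ ≤ ENNReal.ofReal (n * m ^ 2) / ENNReal.ofReal (t ^ 2) := by
        rwa [ENNReal.le_div_iff_mul_le (.inl ht2) (.inl ENNReal.ofReal_ne_top), mul_comm]
    _ ≤ 1 / 3 := by
        have h3 : (1 / 3 : ℝ≥0∞) = ENNReal.ofReal (1 / 3) := by
          rw [ENNReal.ofReal_div_of_pos (by norm_num)]; simp
        rw [← ENNReal.ofReal_div_of_pos (by positivity), h3]
        refine ENNReal.ofReal_le_ofReal ?_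
        rw [div_le_iff₀ (by positivity)]
        linarith

theorem le_compl_of_le_third {Ω : Type*} [MeasurableSpace Ω] {P : Measure Ω}
    [IsProbabilityMeasure P] {A : Set Ω} (hA : MeasurableSet A) (h : P A ≤ 1 / 3) :
    2 / 3 ≤ P Aᶜ := by
  rw [prob_compl_eq_one_sub hA]
  refine le_trans ?_ (tsub_le_tsub_left h 1)
  refine ENNReal.le_sub_of_add_le_right (by simp) ?_
  rw [← ENNReal.add_div]
  norm_num

theorem meanTester_testsGaussianMean {ε : ℝ} (hn : 1 ≤ n) (hε : 0 < ε) (hε1 : ε ≤ 1)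
    (hq : 900 * (√(n : ℝ) / ε ^ 2) ≤ q) :
    TestsGaussianMean n q ε fun ν b => ν (outputSet meanTester n q ε b) := by
  have hn1 : (1 : ℝ) ≤ √(n : ℝ) := Real.one_le_sqrt.2 (by exact_mod_cast hn)
  have hε2 : 0 < ε ^ 2 := by positivity
  have hdiv : √(n : ℝ) ≤ √(n : ℝ) / ε ^ 2 := by
    rw [le_div_iff₀ hε2]
    exact mul_le_of_le_one_right (by positivity) (pow_le_one₀ hε.le hε1)
  have hq2 : (900 : ℝ) ≤ q := by linarith
  have hq3 : 900 ≤ q := by exact_mod_cast hq2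
  have hm3 : (q : ℝ) ≤ 3 * ((q / 2 : ℕ) : ℝ) := by
    have : q ≤ 3 * (q / 2) := by omega
    exact_mod_cast this
  set m : ℝ := ((q / 2 : ℕ) : ℝ) with hm
  have hm0 : 0 < m := by linarith
  have hcond (x : Fin q → EuclideanSpace ℝ (Fin n)) :
      (ε * m) ^ 4 < (inner ℝ (paritySum 0 x) (paritySum 1 x) * 144) ^ 2 ↔
        (ε * m) ^ 2 / 144 < |inner ℝ (paritySum 0 x) (paritySum 1 x)| := by
    rw [show (ε * m) ^ 4 = ((ε * m) ^ 2) ^ 2 by ring, sq_lt_sq, abs_mul,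
      abs_of_nonneg (sq_nonneg (ε * m)), div_lt_iff₀ (by norm_num), abs_of_pos (by norm_num : (0:ℝ) < 144)]
  have hprob (μ S) : IsProbabilityMeasure (gaussianSamples n q μ S) := by
    unfold gaussianSamples; infer_instance
  refine ⟨?_, fun μ S _ hμ => ?_⟩
  · have h := le_compl_of_le_third (measurableSet_lt (by fun_prop) (by fun_prop))
      (gaussianSamples_lt_abs_inner (n := n) (q := q) (t := (ε * m) ^ 2 / 144) (by positivity) ?_)
    · convert! h using 2
      rw [outputSet_meanTester hn]
      ext x
      simp [← hm, ← hcond]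
    · rw [← hm]
      -- The constant 900 is `3 * 300`: `m ≥ q / 3` loses the factor 3, and `300² ≥ 3 * 144²` is
      -- what Markov's inequality requires.
      have h1 : 300 * √(n : ℝ) ≤ ε ^ 2 * m := by
        have : 300 * (√(n : ℝ) / ε ^ 2) ≤ m := by linarith
        rw [← mul_div_assoc, div_le_iff₀ hε2] at this
        linarith
      have h2 : (300 * √(n : ℝ)) ^ 2 ≤ (ε ^ 2 * m) ^ 2 := by gcongr
      rw [mul_pow, Real.sq_sqrt (by positivity)] at h2
      have h3 := mul_le_mul_of_nonneg_right h2 (sq_nonneg m)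
      have h4 : ((ε * m) ^ 2 / 144) ^ 2 = (ε ^ 2 * m) ^ 2 * m ^ 2 / 144 ^ 2 := by ring
      rw [h4, le_div_iff₀ (by norm_num)]
      nlinarith [mul_nonneg (Nat.cast_nonneg (α := ℝ) n) (sq_nonneg m)]
  · have h := le_compl_of_le_third (measurableSet_le (by fun_prop) (by fun_prop))
      (gaussianSamples_abs_inner_le (S := S) (q := q) (by omega) hε hμ)
    convert! h using 2
    rw [outputSet_meanTester hn]
    ext x
    simp [← hm, hcond]

end RealRAM

/-! ### Likelihood ratios of Gaussians with identity covariance -/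

theorem lintegral_pi_prod {ι : Type*} [Fintype ι] {Ω : ι → Type*} [∀ i, MeasurableSpace (Ω i)]
    (ν : ∀ i, Measure (Ω i)) [∀ i, IsProbabilityMeasure (ν i)] {f : ∀ i, Ω i → ℝ≥0∞}
    (hf : ∀ i, Measurable (f i)) :
    ∫⁻ x, ∏ i, f i (x i) ∂(Measure.pi ν) = ∏ i, ∫⁻ y, f i y ∂(ν i) := by
  rw [lintegral_prod_eq_prod_lintegral_of_indepFun Finset.univ (fun i (x : ∀ i, Ω i) => f i (x i))
    (iIndepFun_pi fun i => (hf i).aemeasurable) fun i => (hf i).comp (measurable_pi_apply i)]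
  exact Finset.prod_congr rfl fun i _ => (measurePreserving_eval ν i).lintegral_comp (hf i)

/-- It suffices to compare on boxes, where the indicator times the product density factors over the
coordinates. -/
theorem pi_withDensity {ι : Type*} [Fintype ι] {Ω : ι → Type*} [∀ i, MeasurableSpace (Ω i)]
    (ν ν' : ∀ i, Measure (Ω i)) [∀ i, IsProbabilityMeasure (ν i)] [∀ i, SigmaFinite (ν' i)]
    {g : ∀ i, Ω i → ℝ≥0∞} (hg : ∀ i, Measurable (g i)) (h : ∀ i, ν' i = (ν i).withDensity (g i)) :
    Measure.pi ν' = (Measure.pi ν).withDensity fun x => ∏ i, g i (x i) := by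
  refine (Measure.pi_eq fun s hs => ?_)
  rw [withDensity_apply _ (MeasurableSet.univ_pi hs), ← lintegral_indicator (MeasurableSet.univ_pi hs)]
  have : (Set.univ.pi s).indicator (fun x => ∏ i, g i (x i)) =
      fun x => ∏ i, (s i).indicator (g i) (x i) := by
    ext x
    by_cases hx : x ∈ Set.univ.pi s
    · rw [Set.indicator_of_mem hx]
      exact Finset.prod_congr rfl fun i _ => (Set.indicator_of_mem (hx i trivial) _).symm
    · rw [Set.indicator_of_notMem hx]
      obtain ⟨i, hi⟩ : ∃ i, x i ∉ s i := by simpa using hx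
      exact (Finset.prod_eq_zero (Finset.mem_univ i) (Set.indicator_of_notMem hi _)).symm
  rw [this, lintegral_pi_prod ν fun i => (hg i).indicator (hs i)]
  refine Finset.prod_congr rfl fun i _ => ?_
  rw [h, withDensity_apply _ (hs i), lintegral_indicator (hs i)]

theorem gaussianReal_one_eq_withDensity (a : ℝ) :
    gaussianReal a 1 =
      (gaussianReal 0 1).withDensity fun x => ENNReal.ofReal (Real.exp (a * x - a ^ 2 / 2)) := by
  rw [gaussianReal_of_var_ne_zero a one_ne_zero, gaussianReal_of_var_ne_zero 0 one_ne_zero,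
    ← withDensity_mul _ (measurable_gaussianPDF 0 1) (by fun_prop)]
  congr 1
  ext x
  rw [Pi.mul_apply, gaussianPDF, gaussianPDF, ← ENNReal.ofReal_mul (gaussianPDFReal_nonneg _ _ _),
    gaussianPDFReal_def, gaussianPDFReal_def]
  simp only [NNReal.coe_one]
  rw [mul_assoc (√(2 * Real.pi * 1))⁻¹, ← Real.exp_add]
  congr 3
  ring

theorem multivariateGaussian_one_eq_map_pi {ι : Type*} [Fintype ι] [DecidableEq ι]
    (μ : EuclideanSpace ℝ ι) :
    multivariateGaussian μ 1 =
      (Measure.pi fun j => gaussianReal (μ j) 1).map (WithLp.toLp 2) := by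
  have h : multivariateGaussian μ 1 = (stdGaussian (EuclideanSpace ℝ ι)).map (fun x => μ + x) := by
    simp [multivariateGaussian]
  rw [h, ← map_pi_eq_stdGaussian, Measure.map_map (by fun_prop) (by fun_prop)]
  have h2 : (fun x => μ + x) ∘ (WithLp.toLp 2) =
      (WithLp.toLp 2) ∘ (fun (x : ι → ℝ) j => μ j + x j) := by
    ext x j
    simp
  rw [h2, ← Measure.map_map (by fun_prop) (by fun_prop),
    Measure.pi_map_pi (f := fun j y => μ j + y) (fun j => by fun_prop)]
  simp [gaussianReal_map_const_add]

theorem multivariateGaussian_one_eq_withDensity {ι : Type*} [Fintype ι] [DecidableEq ι]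
    (μ : EuclideanSpace ℝ ι) :
    multivariateGaussian μ 1 = (multivariateGaussian 0 1).withDensity
      fun x => ENNReal.ofReal (Real.exp (inner ℝ μ x - ‖μ‖ ^ 2 / 2)) := by
  have hp := pi_withDensity (fun _ : ι => gaussianReal 0 1) (fun j => gaussianReal (μ j) 1)
    (g := fun j x => ENNReal.ofReal (Real.exp (μ j * x - μ j ^ 2 / 2)))
    (fun j => by fun_prop) (fun j => gaussianReal_one_eq_withDensity (μ j))
  rw [multivariateGaussian_one_eq_map_pi, hp, multivariateGaussian_one_eq_map_pi]
  have hd : (fun x : ι → ℝ => ∏ j, ENNReal.ofReal (Real.exp (μ j * x j - μ j ^ 2 / 2))) =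
      (fun x => ENNReal.ofReal (Real.exp (inner ℝ μ x - ‖μ‖ ^ 2 / 2))) ∘ (WithLp.toLp 2) := by
    ext x
    rw [← ENNReal.ofReal_prod_of_nonneg fun _ _ => (Real.exp_pos _).le, ← Real.exp_sum,
      Finset.sum_sub_distrib, Function.comp_apply, EuclideanSpace.real_norm_sq_eq,
      PiLp.inner_apply, Finset.sum_div]
    simp [mul_comm]
  ext s hs
  rw [hd, Measure.map_apply (by fun_prop) hs, withDensity_apply _ hs,
    withDensity_apply _ ((by fun_prop : Measurable (WithLp.toLp 2)) hs),
    setLIntegral_map hs (by fun_prop) (by fun_prop)]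
  rfl

/-- The likelihood ratio of `q` samples for the means `μ` and `0`. -/
noncomputable def likelihoodRatio {n q : ℕ} (μ : EuclideanSpace ℝ (Fin n))
    (x : Fin q → EuclideanSpace ℝ (Fin n)) : ℝ :=
  Real.exp (∑ i, (inner ℝ μ (x i) - ‖μ‖ ^ 2 / 2))

section

variable {n q : ℕ}

instance (μ : EuclideanSpace ℝ (Fin n)) (S : Matrix (Fin n) (Fin n) ℝ) :
    IsProbabilityMeasure (gaussianSamples n q μ S) := by
  unfold gaussianSamples; infer_instance

@[fun_prop]
theorem measurable_likelihoodRatio (μ : EuclideanSpace ℝ (Fin n)) :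
    Measurable (likelihoodRatio (q := q) μ) := by
  unfold likelihoodRatio; fun_prop

theorem likelihoodRatio_pos (μ : EuclideanSpace ℝ (Fin n)) (x : Fin q → EuclideanSpace ℝ (Fin n)) :
    0 < likelihoodRatio μ x := Real.exp_pos _

theorem gaussianSamples_one_eq_withDensity (μ : EuclideanSpace ℝ (Fin n)) :
    gaussianSamples n q μ 1 = (gaussianSamples n q 0 1).withDensity
      fun x => ENNReal.ofReal (likelihoodRatio μ x) := by
  rw [gaussianSamples, pi_withDensity (fun _ : Fin q => multivariateGaussian 0 1) _
    (fun _ => by fun_prop) (fun _ => multivariateGaussian_one_eq_withDensity μ)]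
  congr 1
  ext x
  rw [← ENNReal.ofReal_prod_of_nonneg fun _ _ => (Real.exp_pos _).le, ← Real.exp_sum]
  rfl

theorem lintegral_likelihoodRatio (μ : EuclideanSpace ℝ (Fin n)) :
    ∫⁻ x, ENNReal.ofReal (likelihoodRatio μ x) ∂(gaussianSamples n q 0 1) = 1 := by
  have h := measure_univ (μ := gaussianSamples n q μ 1)
  rwa [gaussianSamples_one_eq_withDensity, withDensity_apply _ .univ, Measure.restrict_univ] at h

theorem integrable_likelihoodRatio (μ : EuclideanSpace ℝ (Fin n)) :
    Integrable (likelihoodRatio μ) (gaussianSamples n q 0 1) := by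
  refine ⟨by fun_prop, ?_⟩
  rw [hasFiniteIntegral_iff_ofReal (.of_forall fun x => (likelihoodRatio_pos μ x).le),
    lintegral_likelihoodRatio]
  simp

theorem integral_likelihoodRatio (μ : EuclideanSpace ℝ (Fin n)) :
    ∫ x, likelihoodRatio μ x ∂(gaussianSamples n q 0 1) = 1 := by
  rw [integral_eq_lintegral_of_nonneg_ae (.of_forall fun x => (likelihoodRatio_pos μ x).le)
    (by fun_prop), lintegral_likelihoodRatio]
  simp

/-- The cross term of `‖μ + μ'‖²` is all that separates the product from another likelihood ratio.
Integrability and integrals of products thus reduce to the case of one ratio, whose integral is 1.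
-/
theorem likelihoodRatio_mul (μ μ' : EuclideanSpace ℝ (Fin n))
    (x : Fin q → EuclideanSpace ℝ (Fin n)) :
    likelihoodRatio μ x * likelihoodRatio μ' x =
      Real.exp (q * inner ℝ μ μ') * likelihoodRatio (μ + μ') x := by
  simp only [likelihoodRatio, ← Real.exp_add, ← Finset.sum_add_distrib]
  congr 1
  have : (q : ℝ) * inner ℝ μ μ' = ∑ _i : Fin q, inner ℝ μ μ' := by simp
  rw [this, ← Finset.sum_add_distrib]
  refine Finset.sum_congr rfl fun i _ => ?_
  rw [norm_add_sq_real, inner_add_left]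
  ring

theorem integrable_likelihoodRatio_mul (μ μ' : EuclideanSpace ℝ (Fin n)) :
    Integrable (fun x => likelihoodRatio μ x * likelihoodRatio μ' x) (gaussianSamples n q 0 1) := by
  simp only [likelihoodRatio_mul]
  exact (integrable_likelihoodRatio _).const_mul _

theorem integral_likelihoodRatio_mul (μ μ' : EuclideanSpace ℝ (Fin n)) :
    ∫ x, likelihoodRatio μ x * likelihoodRatio μ' x ∂(gaussianSamples n q 0 1) =
      Real.exp (q * inner ℝ μ μ') := by
  simp only [likelihoodRatio_mul]
  rw [integral_const_mul, integral_likelihoodRatio, mul_one]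

theorem integral_gaussianSamples_one (μ : EuclideanSpace ℝ (Fin n))
    (f : (Fin q → EuclideanSpace ℝ (Fin n)) → ℝ) :
    ∫ x, f x ∂(gaussianSamples n q μ 1) =
      ∫ x, likelihoodRatio μ x * f x ∂(gaussianSamples n q 0 1) := by
  rw [gaussianSamples_one_eq_withDensity, integral_withDensity_eq_integral_toReal_smul (by fun_prop)
    (.of_forall fun _ => ENNReal.ofReal_lt_top)]
  simp [ENNReal.toReal_ofReal (likelihoodRatio_pos μ _).le]

/-! ### The second moment method -/

/-- A bounded test which separates mean `0` from all means of a finite family forces the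
mixture over the family to have a second moment bounded away from `1`. -/
theorem second_moment_of_separates {ι : Type*} [Fintype ι] [Nonempty ι]
    (μ : ι → EuclideanSpace ℝ (Fin n)) {f : (Fin q → EuclideanSpace ℝ (Fin n)) → ℝ}
    (hf : Measurable f) (hf0 : ∀ x, 0 ≤ f x) (hf1 : ∀ x, f x ≤ 1)
    (h0 : 2 / 3 ≤ ∫ x, f x ∂(gaussianSamples n q 0 1))
    (h1 : ∀ s, ∫ x, f x ∂(gaussianSamples n q (μ s) 1) ≤ 1 / 3) :
    10 / 9 * (Fintype.card ι : ℝ) ^ 2 ≤ ∑ s, ∑ s', Real.exp (q * inner ℝ (μ s) (μ s')) := by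
  set N : ℝ := (Fintype.card ι : ℝ) with hN
  have hNpos : 0 < N := by rw [hN]; exact_mod_cast Fintype.card_pos
  set P := gaussianSamples n q 0 1
  -- `L` is `N` times the likelihood ratio of the uniform mixture.
  set L : (Fin q → EuclideanSpace ℝ (Fin n)) → ℝ := fun x => ∑ s, likelihoodRatio (μ s) x
  have hLi : Integrable L P := integrable_finsetSum _ fun s _ => integrable_likelihoodRatio _
  have hL1 : ∫ x, L x ∂P = N := by
    simp only [L]
    rw [integral_finsetSum _ fun s _ => integrable_likelihoodRatio _]
    simp [integral_likelihoodRatio, hN]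
  have hLL : ∀ x, L x ^ 2 = ∑ s, ∑ s', likelihoodRatio (μ s) x * likelihoodRatio (μ s') x :=
    fun x => by simp only [L]; rw [sq, Finset.sum_mul_sum]
  have hLLi : Integrable (fun x => L x ^ 2) P := by
    simp only [hLL]
    exact integrable_finsetSum _ fun s _ => integrable_finsetSum _ fun s' _ =>
      integrable_likelihoodRatio_mul _ _
  have hL2 : ∫ x, L x ^ 2 ∂P = ∑ s, ∑ s', Real.exp (q * inner ℝ (μ s) (μ s')) := by
    simp only [hLL]
    rw [integral_finsetSum _ fun s _ => integrable_finsetSum _ fun s' _ =>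
      integrable_likelihoodRatio_mul _ _]
    refine Finset.sum_congr rfl fun s _ => ?_
    rw [integral_finsetSum _ fun s' _ => integrable_likelihoodRatio_mul _ _]
    exact Finset.sum_congr rfl fun s' _ => integral_likelihoodRatio_mul _ _
  have hfi : Integrable f P := .of_bound (by fun_prop) 1
    (.of_forall fun x => by rw [Real.norm_of_nonneg (hf0 x)]; exact hf1 x)
  have hmul : ∀ s, Integrable (fun x => likelihoodRatio (μ s) x * f x) P := fun s =>
    (integrable_likelihoodRatio (μ s)).mul_bdd (c := 1) (by fun_prop)
      (.of_forall fun x => by rw [Real.norm_of_nonneg (hf0 x)]; exact hf1 x)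
  have hLf : Integrable (fun x => L x * f x) P := by
    simp only [L, Finset.sum_mul]
    exact integrable_finsetSum _ fun s _ => hmul s
  have hLf1 : ∫ x, L x * f x ∂P ≤ N / 3 := by
    simp only [L, Finset.sum_mul]
    rw [integral_finsetSum _ fun s _ => hmul s]
    calc _ ≤ ∑ _s : ι, (1 / 3 : ℝ) := Finset.sum_le_sum fun s _ => by
          rw [← integral_gaussianSamples_one]; exact h1 s
      _ = N / 3 := by simp [hN]; ring
  -- For `N = 1` this is `f (1 - L) ≤ f² / 6 + 3/2 (1 - L)²` with `f² ≤ 1`. Since `f (1 - L)` has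
  -- integral at least `2/3 - 1/3`, integration yields `∫ L² ≥ 10/9`.
  have hpt : ∀ x, N ^ 2 * f x - N * (L x * f x) + (3 * N * L x - 3 / 2 * L x ^ 2) ≤
      5 / 3 * N ^ 2 := by
    intro x
    nlinarith [sq_nonneg (N * f x - 3 * (N - L x)), mul_nonneg (sq_nonneg N)
      (mul_nonneg (hf0 x) (sub_nonneg.2 (hf1 x))), mul_nonneg (sq_nonneg N) (sub_nonneg.2 (hf1 x))]
  have i1 : Integrable (fun x => N ^ 2 * f x - N * (L x * f x)) P :=
    (hfi.const_mul (N ^ 2)).sub (hLf.const_mul N)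
  have i2 : Integrable (fun x => 3 * N * L x - 3 / 2 * L x ^ 2) P :=
    (hLi.const_mul (3 * N)).sub (hLLi.const_mul (3 / 2))
  have hint := integral_mono (μ := P) (i1.add i2) (integrable_const (5 / 3 * N ^ 2)) hpt
  simp only [Pi.add_apply] at hint
  rw [integral_add i1 i2, integral_sub (hfi.const_mul (N ^ 2)) (hLf.const_mul N),
    integral_sub (hLi.const_mul (3 * N)) (hLLi.const_mul (3 / 2)), integral_const_mul,
    integral_const_mul, integral_const_mul, integral_const_mul, hL1, hL2] at hint
  simp only [integral_const, probReal_univ, one_smul] at hint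
  nlinarith [mul_le_mul_of_nonneg_left hLf1 hNpos.le, mul_le_mul_of_nonneg_left h0 (sq_nonneg N)]

/-- The vector with entries `± η`. -/
noncomputable def signVector (η : ℝ) (s : Fin n → Bool) : EuclideanSpace ℝ (Fin n) :=
  WithLp.toLp 2 fun j => if s j then η else -η

theorem norm_signVector_sq (η : ℝ) (s : Fin n → Bool) : ‖signVector η s‖ ^ 2 = n * η ^ 2 := by
  rw [EuclideanSpace.real_norm_sq_eq]
  have : ∀ j, (signVector η s) j ^ 2 = η ^ 2 := fun j => by
    simp only [signVector]; split_ifs <;> ring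
  simp [this]

/-- The exponential factors over coordinates, and the two signs of `s' j` contribute `exp (r η²) +
exp (-r η²)` whatever `s j` is. -/
theorem sum_exp_inner_signVector (η r : ℝ) (s : Fin n → Bool) :
    ∑ s' : Fin n → Bool, Real.exp (r * inner ℝ (signVector η s) (signVector η s')) =
      (2 * Real.cosh (r * η ^ 2)) ^ n := by
  have h : ∀ s' : Fin n → Bool, Real.exp (r * inner ℝ (signVector η s) (signVector η s')) =
      ∏ j, Real.exp (r * ((if s j then η else -η) * (if s' j then η else -η))) := by
    intro s'
    rw [← Real.exp_sum, PiLp.inner_apply, Finset.mul_sum]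
    simp [signVector, mul_comm]
  simp only [h]
  have hp := Finset.prod_univ_sum (fun _ : Fin n => (Finset.univ : Finset Bool))
    (fun j b => Real.exp (r * ((if s j then η else -η) * (if b then η else -η))))
  rw [Fintype.piFinset_univ] at hp
  rw [← hp]
  have hj : ∀ j, ∑ b : Bool, Real.exp (r * ((if s j then η else -η) * (if b then η else -η))) =
      2 * Real.cosh (r * η ^ 2) := by
    intro j
    rw [Real.cosh_eq, Fintype.sum_bool]
    cases s j <;> simp only [if_true, if_false, Bool.false_eq_true] <;> ring_nf
  rw [Finset.prod_congr rfl fun j _ => hj j]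
  simp

theorem sample_lower_bound {ε : ℝ} (hn : 1 ≤ n) (hε : 0 < ε)
    (κ : Kernel (Fin q → EuclideanSpace ℝ (Fin n)) Bool) [IsMarkovKernel κ]
    (h : TestsGaussianMean n q ε fun ν b => (ν.bind κ) {b}) :
    1 / 10 * (√(n : ℝ) / ε ^ 2) ≤ q := by
  have hn0 : (0 : ℝ) < n := by exact_mod_cast hn
  set f : (Fin q → EuclideanSpace ℝ (Fin n)) → ℝ := fun x => (κ x {true}).toReal
  have hmeas (b : Bool) : Measurable fun x => κ x {b} := κ.measurable_coe (by simp)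
  have hf : Measurable f := (hmeas true).ennreal_toReal
  have hle (b : Bool) (x) : κ x {b} ≤ 1 := prob_le_one
  have hbind (ν : Measure (Fin q → EuclideanSpace ℝ (Fin n))) [IsProbabilityMeasure ν] (b : Bool)
      (hb : 2 / 3 ≤ ν.bind κ {b}) : 2 / 3 ≤ ∫ x, (κ x {b}).toReal ∂ν := by
    rw [Measure.bind_apply (by simp) κ.measurable.aemeasurable] at hb
    rw [integral_toReal (hmeas b).aemeasurable
      (.of_forall fun x => (hle b x).trans_lt ENNReal.one_lt_top)]
    have hfin : ∫⁻ x, κ x {b} ∂ν ≠ ∞ :=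
      ((lintegral_mono (hle b)).trans_lt (by simp)).ne
    have := ENNReal.toReal_mono hfin hb
    simpa using this
  -- This gives the sign vectors norm `2ε`, strictly above `ε`.
  set η : ℝ := 2 * ε / √(n : ℝ) with hη
  have hη2 : η ^ 2 = 4 * ε ^ 2 / n := by
    rw [hη, div_pow, Real.sq_sqrt hn0.le]; ring
  have key := second_moment_of_separates (q := q) (signVector (n := n) η) hf
    (fun x => ENNReal.toReal_nonneg)
    (fun x => ENNReal.toReal_le_of_le_ofReal zero_le_one (by simpa using hle true x))
    (hbind _ true h.1) ?_
  · simp only [sum_exp_inner_signVector] at key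
    rw [Finset.sum_const, Finset.card_univ, nsmul_eq_mul] at key
    simp only [Fintype.card_pi, Fintype.card_bool, Finset.prod_const, Finset.card_univ,
      Fintype.card_fin, mul_pow] at key
    push_cast at key
    have hpow : (0 : ℝ) < 2 ^ n := by positivity
    have key2 : 10 / 9 ≤ Real.cosh (q * η ^ 2) ^ n := by
      have : (2 : ℝ) ^ n * 2 ^ n * (10 / 9) ≤ 2 ^ n * 2 ^ n * Real.cosh (q * η ^ 2) ^ n := by
        linarith
      exact le_of_mul_le_mul_left this (by positivity)
    have key3 : 10 / 9 ≤ Real.exp (8 * (q * ε ^ 2) ^ 2 / n) := by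
      calc (10 / 9 : ℝ) ≤ Real.cosh (q * η ^ 2) ^ n := key2
        _ ≤ Real.exp ((q * η ^ 2) ^ 2 / 2) ^ n := by
          gcongr
          exact Real.cosh_le_exp_half_sq _
        _ = Real.exp (8 * (q * ε ^ 2) ^ 2 / n) := by
          rw [← Real.exp_nat_mul, hη2]
          congr 1
          field_simp
          ring
    by_contra! hlt
    have h1 : (q : ℝ) * ε ^ 2 ≤ 1 / 10 * √(n : ℝ) := by
      rw [← mul_div_assoc, lt_div_iff₀ (by positivity)] at hlt
      exact hlt.le
    have h2 : 8 * ((q : ℝ) * ε ^ 2) ^ 2 / n ≤ 8 / 100 := by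
      rw [div_le_iff₀ hn0]
      have : ((q : ℝ) * ε ^ 2) ^ 2 ≤ (1 / 10 * √(n : ℝ)) ^ 2 := by gcongr
      rw [mul_pow (1 / 10 : ℝ), Real.sq_sqrt hn0.le] at this
      linarith
    have h3 := Real.exp_le_exp.2 h2
    -- Hence `exp 0.08 ≤ 1 / 0.92 < 10 / 9`, the contradiction sought.
    have h4 := Real.add_one_le_exp (-(8 / 100 : ℝ))
    have h5 : Real.exp (8 / 100) * Real.exp (-(8 / 100 : ℝ)) = 1 := by
      rw [← Real.exp_add]; simp
    have h6 : (10 / 9 : ℝ) ≤ Real.exp (8 / 100) := key3.trans h3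
    nlinarith
  · intro s
    have hμ : ε < ‖signVector η s‖ := by
      refine lt_of_pow_lt_pow_left₀ 2 (norm_nonneg _) ?_
      rw [norm_signVector_sq, hη2]
      have : (n : ℝ) * (4 * ε ^ 2 / n) = 4 * ε ^ 2 := by field_simp
      rw [this]
      nlinarith [sq_pos_of_pos hε]
    have h2 := hbind _ false (h.2 (signVector η s) 1 Matrix.PosSemidef.one hμ)
    have hsum : ∀ x, (κ x {false}).toReal = 1 - f x := by
      intro x
      have hc : ({false} : Set Bool) = {true}ᶜ := by ext b; cases b <;> simp
      rw [hc, prob_compl_eq_one_sub (by simp), ENNReal.toReal_sub_of_le (hle true x) (by simp)]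
      simp [f]
    simp only [hsum] at h2
    rw [integral_sub (integrable_const _)] at h2
    · simp only [integral_const, probReal_univ, one_smul] at h2
      linarith
    · refine .of_bound (by fun_prop) 1 (.of_forall fun x => ?_)
      rw [Real.norm_of_nonneg ENNReal.toReal_nonneg]
      exact ENNReal.toReal_le_of_le_ofReal zero_le_one (by simpa using hle true x)

end

/-! ### The main theorem -/

theorem theorem4p9 :
    -- the algorithm: one program for all `n`, `q`, `ε`
    (∃ (P : RealRAM.Prog) (C : ℝ) (K : ℕ), 0 < C ∧
      ∀ (n q : ℕ) (ε : ℝ), 1 ≤ n → 0 < ε → ε ≤ 1 →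
        -- running time, on every input
        (∀ x : Fin q → EuclideanSpace ℝ (Fin n), ∃ (b : Bool) (t : ℕ),
          RealRAM.OutputsIn P n q ε x b t ∧
          (t : ℝ) ≤ K * ((q : ℝ) + (n : ℝ) ^ Real.log n) ^ K) ∧
        -- correctness
        (C * (√(n : ℝ) / ε ^ 2) ≤ q →
          TestsGaussianMean n q ε fun ν b => ν (RealRAM.outputSet P n q ε b))) ∧
    -- the lower bound, for arbitrary randomized procedures
    (∃ c : ℝ, 0 < c ∧
      ∀ (n q : ℕ) (ε : ℝ), 1 ≤ n → 0 < ε → ε ≤ 1 →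
        ∀ κ : ProbabilityTheory.Kernel (Fin q → EuclideanSpace ℝ (Fin n)) Bool,
          ProbabilityTheory.IsMarkovKernel κ →
          (TestsGaussianMean n q ε fun ν b => (ν.bind κ) {b}) →
          c * (√(n : ℝ) / ε ^ 2) ≤ q) := by
  refine ⟨⟨RealRAM.meanTester, 900, 100, by norm_num, fun n q ε hn hε hε1 => ⟨fun x => ?_,
    RealRAM.meanTester_testsGaussianMean hn hε hε1⟩⟩, 1 / 10, by norm_num,
    fun n q ε hn hε _ κ _ h => sample_lower_bound hn hε κ h⟩
  exact ⟨_, _, RealRAM.meanTester_outputsIn hn x, meanTester_time_le q hn⟩
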